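/- For $d,s\ge 1$, the induced measure $\mu_{d,s}$ is the law of the random $d\times d$ density matrix $\mathrm{Tr}_{\mathbb C^s}(\psi\psi^*)$, where $\psi$ is uniformly distributed on the unit sphere of $\mathbb C^d\otimes\mathbb C^s$. For a matrix $X\in M_n(\mathbb C)\otimes M_k(\mathbb C)$ write $X_A=(\mathrm{id}\otimes \mathrm{Tr})(X)\in M_n(\mathbb C)$; we say that $X$ has positive reduction if $X^{red}:=X_A\otimes I_k-X$ is positive semidefinite. Theorem 4.1. Let $c>0$ and let $(k_n)$, $(s_n)$ be sequences of natural numbers such that, as $n\to\infty$, $k_n\to\infty$ (at an arbitrary speed compared with $n$) and $s_n\sim cn$, i.e. $s_n/(cn)\to 1$. For all sufficiently large $n$, let $\rho_n$ be a random matrix in $M_n(\mathbb C)\otimes M_{k_n}(\mathbb C)\cong M_{nk_n}(\mathbb C)$ with distribution $\mu_{nk_n,s_n}$. Then: 1. if $c<1$, then $\lim_{n\to\infty}\mathbb P[\rho_n\text{ has positive reduction}]=0$; 2. if $c>1$, then $\lim_{n\to\infty}\mathbb P[\rho_n\text{ has positive reduction}]=1$. In other words, in the regime $n,k_n\to\infty$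 the threshold for the reduction criterion on the scale $s_n\sim cn$ is $c=1$. -/

import Mathlib

open MeasureTheory ProbabilityTheory Filter Topology
open scoped Kronecker ComplexOrder

/-- The product (= Borel) sigma-algebra on matrices. -/
instance matrixMeasurableSpace {ι κ α : Type*} [MeasurableSpace α] :
    MeasurableSpace (Matrix ι κ α) :=
  MeasurableSpace.pi

/-- The uniform (Haar) probability measure on the unit sphere of `ℂ^ι`: the surface measure, scaled
to total mass one. (If `ι` is empty, the sphere is empty and this is the zero measure.) -/
noncomputable def uniformSphere (ι : Type*) [Fintype ι] :
    Measure (Metric.sphere (0 : EuclideanSpace ℂ ι) 1) :=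
  ((volume : Measure (EuclideanSpace ℂ ι)).toSphere Set.univ)⁻¹ •
    (volume : Measure (EuclideanSpace ℂ ι)).toSphere

/-- The partial trace over the second tensor factor,
`id ⊗ Tr : M_ι(ℂ) ⊗ M_κ(ℂ) → M_ι(ℂ)`. -/
def partialTrace {ι κ : Type*} [Fintype κ] (X : Matrix (ι × κ) (ι × κ) ℂ) : Matrix ι ι ℂ :=
  Matrix.of fun i j => ∑ a, X (i, a) (j, a)

/-- The rank-one matrix `ψ ψ*`. -/
def pureState {ι : Type*} (ψ : EuclideanSpace ℂ ι) : Matrix ι ι ℂ :=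
  Matrix.of fun i j => ψ i * star (ψ j)

/-- The induced measure: the law of `Tr_{ℂ^σ}(ψ ψ*)`, where `ψ` is uniformly distributed on the unit
sphere of `ℂ^δ ⊗ ℂ^σ`. Its parameters `(d, s)` are the cardinalities of `δ` and `σ`. -/
noncomputable def inducedMeasure (δ σ : Type*) [Fintype δ] [Fintype σ] : Measure (Matrix δ δ ℂ) :=
  (uniformSphere (δ × σ)).map fun ψ : Metric.sphere (0 : EuclideanSpace ℂ (δ × σ)) 1 =>
    partialTrace (pureState (ψ : EuclideanSpace ℂ (δ × σ)))

/-- The reduction over the second tensor factor, `X^red = X_A ⊗ I - X`. -/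
def reduction {ι κ : Type*} [Fintype κ] [DecidableEq κ] (X : Matrix (ι × κ) (ι × κ) ℂ) :
    Matrix (ι × κ) (ι × κ) ℂ :=
  partialTrace X ⊗ₖ (1 : Matrix κ κ ℂ) - X

/-- `X` has positive reduction: `X^red` is positive semidefinite. -/
def HasPositiveReduction {ι κ : Type*} [Fintype ι] [Fintype κ] [DecidableEq κ]
    (X : Matrix (ι × κ) (ι × κ) ℂ) : Prop :=
  (reduction X).PosSemidef

/-! Regard `ψ` in `ℂⁿ ⊗ ℂᵏ ⊗ ℂˢ` as a map out of one tensor factor. If that factor is much smaller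
than the rest, the map is, up to scale, nearly an isometry. Two cuts matter. Across `n | ks` the
marginal on `ℂⁿ` is close to `I / n`. Across `s | nk` all `s` nonzero eigenvalues of `ρ` are close
to `1 / s`. So `ρ_A ⊗ I - ρ` is positive when `1 / n` exceeds `1 / s` by a fixed factor, and fails
to be when it is smaller by a fixed factor; hence the threshold `s = n`.

Flatness of a cut (`uniformSphere_not_nearlyIsometric_le`) comes from concentration at one unit
vector and a union bound over a net. Concentration is a Chernoff bound on the sphere, obtained by
comparing Gaussian integrals over a cone (`uniformSphere_quadratic_nonneg_le`). The net costs a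
factor exponential in the small dimension, and the tail decays exponentially in the large one. The
ratios `ks / n` and `nk / s` are of order `k`, so `k → ∞` at any speed suffices. -/

/-! ### Nets on the unit sphere -/

/-- Volumetric bound on the size of a `δ`-separated subset of the unit sphere. -/
theorem card_le_of_separated_sphere {E : Type*} [NormedAddCommGroup E] [NormedSpace ℝ E]
    [FiniteDimensional ℝ E] {δ : ℝ} (hδ : 0 < δ) (s : Finset E) (hs : ∀ c ∈ s, ‖c‖ = 1)
    (h : ∀ c ∈ s, ∀ d ∈ s, c ≠ d → δ ≤ ‖c - d‖) :
    (s.card : ℝ) ≤ (1 + 2 / δ) ^ Module.finrank ℝ E := by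
  borelize E
  let μ : Measure E := Measure.addHaar
  have hδ2 : 0 < δ / 2 := by positivity
  have hρ : 0 < 1 + δ / 2 := by positivity
  have D : Set.Pairwise (s : Set E)
      (Function.onFun Disjoint fun c => Metric.ball (c : E) (δ / 2)) := by
    rintro c hc d hd hcd
    apply Metric.ball_disjoint_ball
    rw [dist_eq_norm]
    linarith [h c hc d hd hcd]
  have A_subset : (⋃ c ∈ s, Metric.ball (c : E) (δ / 2)) ⊆ Metric.ball (0 : E) (1 + δ / 2) := by
    refine Set.iUnion₂_subset fun x hx => Metric.ball_subset_ball' ?_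
    rw [dist_zero_right, hs x hx, add_comm]
  have I : (s.card : ENNReal) * ENNReal.ofReal ((δ / 2) ^ Module.finrank ℝ E) * μ (Metric.ball 0 1) ≤
      ENNReal.ofReal ((1 + δ / 2) ^ Module.finrank ℝ E) * μ (Metric.ball 0 1) := by
    rw [← μ.addHaar_ball_of_pos 0 hρ]
    refine le_trans (le_of_eq ?_) (measure_mono A_subset)
    rw [measure_biUnion_finset D fun c _ => measurableSet_ball]
    simp only [μ.addHaar_ball_of_pos _ hδ2]
    simp only [Finset.sum_const, nsmul_eq_mul, mul_assoc]
  have J := (ENNReal.mul_le_mul_iff_left (Metric.measure_ball_pos μ _ zero_lt_one).ne'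
    measure_ball_lt_top.ne).1 I
  have K := ENNReal.toReal_le_of_le_ofReal (by positivity) J
  rw [ENNReal.toReal_mul, ENNReal.toReal_natCast, ENNReal.toReal_ofReal (by positivity)] at K
  rw [← le_div_iff₀ (by positivity), ← div_pow] at K
  have hq : 1 + 2 / δ = (1 + δ / 2) / (δ / 2) := by
    field_simp
    ring
  rwa [hq]

/-- The unit sphere has a `δ`-net of size at most `(1 + 2 / δ) ^ dim`. -/
theorem exists_net_sphere (E : Type*) [NormedAddCommGroup E] [NormedSpace ℝ E]
    [FiniteDimensional ℝ E] {δ : ℝ} (hδ : 0 < δ) :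
    ∃ s : Finset E, (∀ c ∈ s, ‖c‖ = 1) ∧ (∀ u : E, ‖u‖ = 1 → ∃ v ∈ s, ‖u - v‖ ≤ δ) ∧
      (s.card : ℝ) ≤ (1 + 2 / δ) ^ Module.finrank ℝ E := by
  classical
  let K : Set ℕ := {m | ∃ s : Finset E, (∀ c ∈ s, ‖c‖ = 1) ∧
    (∀ c ∈ s, ∀ d ∈ s, c ≠ d → δ ≤ ‖c - d‖) ∧ s.card = m}
  have hne : K.Nonempty := ⟨0, ∅, by simp, by simp, rfl⟩
  have hbdd : BddAbove K := by
    refine ⟨⌊(1 + 2 / δ) ^ Module.finrank ℝ E⌋₊, ?_⟩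
    rintro m ⟨s, h1, h2, rfl⟩
    exact Nat.le_floor (card_le_of_separated_sphere hδ s h1 h2)
  -- A separated set of maximal size is a net: a point further than `δ` from all of it could be
  -- adjoined.
  obtain ⟨s, h1, h2, h3⟩ := Nat.sSup_mem hne hbdd
  refine ⟨s, h1, fun u hu => ?_, card_le_of_separated_sphere hδ s h1 h2⟩
  by_contra! hcon
  have hus : u ∉ s := fun hmem => by
    have := hcon u hmem
    simp only [sub_self, norm_zero] at this
    linarith
  have : (insert u s).card ∈ K := by
    refine ⟨insert u s, ?_, ?_, rfl⟩
    · intro c hc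
      rcases Finset.mem_insert.1 hc with rfl | hc
      exacts [hu, h1 c hc]
    · intro c hc d hd hcd
      rcases Finset.mem_insert.1 hc with rfl | hc' <;> rcases Finset.mem_insert.1 hd with rfl | hd'
      · exact absurd rfl hcd
      · exact (hcon d hd').le
      · rw [norm_sub_rev]; exact (hcon c hc').le
      · exact h2 c hc' d hd' hcd
  have := le_csSup hbdd this
  rw [Finset.card_insert_of_notMem hus, h3] at this
  omega

/-- Control of a linear map on a `δ`-net of the sphere gives control on the whole space. -/
theorem norm_bounds_of_net {E F : Type*} [NormedAddCommGroup E] [NormedSpace ℂ E]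
    [NormedAddCommGroup F] [NormedSpace ℂ F] (T : E →L[ℂ] F) (s : Finset E) {δ α β : ℝ}
    (hδ0 : 0 ≤ δ) (hδ : δ < 1) (hs : ∀ u : E, ‖u‖ = 1 → ∃ v ∈ s, ‖u - v‖ ≤ δ)
    (hβ0 : 0 ≤ β) (hα : ∀ v ∈ s, α ≤ ‖T v‖) (hβ : ∀ v ∈ s, ‖T v‖ ≤ β) (u : E) :
    (α - δ * (β / (1 - δ))) * ‖u‖ ≤ ‖T u‖ ∧ ‖T u‖ ≤ β / (1 - δ) * ‖u‖ := by
  have key : ∀ u : E, ‖u‖ = 1 → ∃ v ∈ s, ‖T u - T v‖ ≤ δ * ‖T‖ := by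
    intro u hu
    obtain ⟨v, hv, huv⟩ := hs u hu
    refine ⟨v, hv, ?_⟩
    rw [← map_sub]
    refine (T.le_opNorm _).trans ?_
    rw [mul_comm]
    gcongr
  have hnorm : ∀ (B : ℝ), (∀ u : E, ‖u‖ = 1 → ‖T u‖ ≤ B) → ∀ u, ‖T u‖ ≤ B * ‖u‖ := by
    intro B hB u
    rcases eq_or_ne u 0 with rfl | hu
    · simp
    have hu' : ‖u‖ ≠ 0 := norm_ne_zero_iff.2 hu
    have h1 : ‖((‖u‖⁻¹ : ℝ) : ℂ) • u‖ = 1 := by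
      rw [norm_smul]; simp [hu']
    have h2 := hB _ h1
    rw [map_smul, norm_smul] at h2
    simp only [Complex.norm_real, norm_inv, norm_norm] at h2
    rwa [inv_mul_le_iff₀ (by positivity), mul_comm] at h2
  have hop : ‖T‖ ≤ β / (1 - δ) := by
    -- The bound refers to `‖T‖` itself and is solved for it, which is where `δ < 1` enters.
    have h1 : ‖T‖ ≤ β + δ * ‖T‖ := by
      refine T.opNorm_le_bound (by positivity) (hnorm _ fun u hu => ?_)
      obtain ⟨v, hv, huv⟩ := key u hu
      have := norm_le_norm_add_norm_sub' (T u) (T v)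
      linarith [hβ v hv]
    rw [le_div_iff₀ (by linarith)]
    linarith
  refine ⟨?_, (T.le_opNorm u).trans (by gcongr)⟩
  rcases eq_or_ne u 0 with rfl | hu
  · simp
  have hu' : ‖u‖ ≠ 0 := norm_ne_zero_iff.2 hu
  have h1 : ‖((‖u‖⁻¹ : ℝ) : ℂ) • u‖ = 1 := by
    rw [norm_smul]; simp [hu']
  obtain ⟨v, hv, huv⟩ := key _ h1
  have h2 : α - δ * (β / (1 - δ)) ≤ ‖T (((‖u‖⁻¹ : ℝ) : ℂ) • u)‖ := by
    have h3 := norm_le_norm_add_norm_sub (T (((‖u‖⁻¹ : ℝ) : ℂ) • u)) (T v)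
    have h4 : δ * ‖T‖ ≤ δ * (β / (1 - δ)) := by gcongr
    linarith [hα v hv]
  rw [map_smul, norm_smul] at h2
  simp only [Complex.norm_real, norm_inv, norm_norm] at h2
  rwa [le_inv_mul_iff₀ (by positivity), mul_comm] at h2

/-! ### Polar coordinates, Gaussian integrals and a Chernoff bound on the sphere -/

/-- Polar coordinates as a lower bound for the integral of a function over a cone. -/
theorem toSphere_mul_lintegral_le {E : Type*} [NormedAddCommGroup E] [NormedSpace ℝ E]
    [MeasurableSpace E] [BorelSpace E] [FiniteDimensional ℝ E] (μ : Measure E)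
    [μ.IsAddHaarMeasure] [Nontrivial E]
    {A : Set (Metric.sphere (0 : E) 1)} (hA : MeasurableSet A) {g : ℝ → ENNReal}
    (hg : Measurable g) {F : E → ENNReal}
    (h : ∀ ψ ∈ A, ∀ r : ℝ, 0 < r → g r ≤ F (r • (ψ : E))) :
    μ.toSphere A * ∫⁻ r : Set.Ioi (0 : ℝ), g r ∂(Measure.volumeIoiPow (Module.finrank ℝ E - 1)) ≤
      ∫⁻ x, F x ∂μ := by
  have hmp := μ.measurePreserving_homeomorphUnitSphereProd
  have hgm : Measurable fun r : Set.Ioi (0 : ℝ) => g r := hg.comp measurable_subtype_coe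
  calc _ = ∫⁻ p : Metric.sphere (0 : E) 1 × Set.Ioi (0 : ℝ), A.indicator 1 p.1 * g p.2
        ∂(μ.toSphere.prod (.volumeIoiPow (Module.finrank ℝ E - 1))) := by
        rw [lintegral_prod_mul (f := A.indicator 1) (g := fun r : Set.Ioi (0 : ℝ) => g r)
          (measurable_one.indicator hA).aemeasurable hgm.aemeasurable, lintegral_indicator_one hA]
    _ = ∫⁻ x : ({0}ᶜ : Set E), A.indicator 1 (homeomorphUnitSphereProd E x).1 *
          g (homeomorphUnitSphereProd E x).2 ∂(μ.comap (↑)) := by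
        rw [← hmp.lintegral_comp_emb (Homeomorph.measurableEmbedding _)]
    _ ≤ ∫⁻ x : ({0}ᶜ : Set E), F x ∂(μ.comap (↑)) := by
        refine lintegral_mono fun x => ?_
        by_cases hx : (homeomorphUnitSphereProd E x).1 ∈ A
        · have := h _ hx (homeomorphUnitSphereProd E x).2 (homeomorphUnitSphereProd E x).2.2
          rw [Set.indicator_of_mem hx, Pi.one_apply, one_mul]
          refine this.trans (le_of_eq ?_)
          congr 1
          have h2 := congrArg Subtype.val ((homeomorphUnitSphereProd E).symm_apply_apply x)
          rw [← h2]
          rfl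
        · simp [Set.indicator_of_notMem hx]
    _ = ∫⁻ x in {0}ᶜ, F x ∂μ := lintegral_subtype_comap (measurableSet_singleton _).compl F
    _ ≤ _ := setLIntegral_le_lintegral _ _

/-- For a radial integrand over the whole space polar coordinates are exact. This lets the radial
factor be traded for a full Gaussian integral. -/
theorem lintegral_comp_norm_eq_toSphere {E : Type*} [NormedAddCommGroup E] [NormedSpace ℝ E]
    [MeasurableSpace E] [BorelSpace E] [FiniteDimensional ℝ E] (μ : Measure E)
    [μ.IsAddHaarMeasure] [Nontrivial E] {g : ℝ → ENNReal} (hg : Measurable g) :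
    ∫⁻ x, g ‖x‖ ∂μ = μ.toSphere Set.univ *
      ∫⁻ r : Set.Ioi (0 : ℝ), g r ∂(Measure.volumeIoiPow (Module.finrank ℝ E - 1)) := by
  have hmp := μ.measurePreserving_homeomorphUnitSphereProd
  have hgm : Measurable fun r : Set.Ioi (0 : ℝ) => g r := hg.comp measurable_subtype_coe
  calc _ = ∫⁻ x in {0}ᶜ, g ‖x‖ ∂μ := by rw [restrict_compl_singleton]
    _ = ∫⁻ x : ({0}ᶜ : Set E), g ‖(x : E)‖ ∂(μ.comap (↑)) :=
      (lintegral_subtype_comap (measurableSet_singleton _).compl fun x => g ‖x‖).symm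
    _ = ∫⁻ p : Metric.sphere (0 : E) 1 × Set.Ioi (0 : ℝ), 1 * g p.2
        ∂(μ.toSphere.prod (.volumeIoiPow (Module.finrank ℝ E - 1))) := by
        rw [← hmp.lintegral_comp_emb (Homeomorph.measurableEmbedding _)]
        simp
    _ = _ := by
        rw [lintegral_prod_mul (f := fun _ => 1) (g := fun r : Set.Ioi (0 : ℝ) => g r)
          aemeasurable_const hgm.aemeasurable]
        simp

/-- Comparison of the uniform measure on the sphere with a rotation invariant density. -/
theorem uniformSphere_mul_lintegral_le {J : Type*} [Fintype J] [Nonempty J]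
    {A : Set (Metric.sphere (0 : EuclideanSpace ℂ J) 1)} (hA : MeasurableSet A) {g : ℝ → ENNReal}
    (hg : Measurable g) {F : EuclideanSpace ℂ J → ENNReal}
    (h : ∀ ψ ∈ A, ∀ r : ℝ, 0 < r → g r ≤ F (r • (ψ : EuclideanSpace ℂ J))) :
    uniformSphere J A * ∫⁻ x : EuclideanSpace ℂ J, g ‖x‖ ≤ ∫⁻ x, F x := by
  have h0 : (volume : Measure (EuclideanSpace ℂ J)).toSphere Set.univ ≠ 0 := by
    rw [Ne, Measure.measure_univ_eq_zero]
    exact Measure.toSphere_ne_zero _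
  have ht : (volume : Measure (EuclideanSpace ℂ J)).toSphere Set.univ ≠ ⊤ := measure_ne_top _ _
  rw [lintegral_comp_norm_eq_toSphere _ hg]
  refine le_trans (le_of_eq ?_) (toSphere_mul_lintegral_le volume hA hg h)
  rw [uniformSphere, Measure.smul_apply, smul_eq_mul, ← mul_assoc,
    mul_right_comm _ _ (Measure.toSphere _ Set.univ), ENNReal.inv_mul_cancel h0 ht, one_mul]

instance {J : Type*} [Fintype J] [Nonempty J] : IsProbabilityMeasure (uniformSphere J) := by
  constructor
  have h0 : (volume : Measure (EuclideanSpace ℂ J)).toSphere Set.univ ≠ 0 := by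
    rw [Ne, Measure.measure_univ_eq_zero]
    exact Measure.toSphere_ne_zero _
  rw [uniformSphere, Measure.smul_apply, smul_eq_mul]
  exact ENNReal.inv_mul_cancel h0 (measure_ne_top _ _)

/-- Both sides are Haar measures on one space. The constant is never evaluated, since only ratios of
integrals are used. -/
theorem exists_volume_euclidean_complex_eq (J : Type*) [Fintype J] :
    ∃ C : NNReal, (volume : Measure (EuclideanSpace ℂ J)) =
      C • (volume : Measure (J → ℂ)).map (WithLp.toLp 2) := by
  let e : (J → ℂ) ≃L[ℝ] EuclideanSpace ℂ J :=
    (PiLp.continuousLinearEquiv 2 ℝ (fun _ : J => ℂ)).symm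
  have : ((volume : Measure (J → ℂ)).map e).IsAddHaarMeasure := e.isAddHaarMeasure_map _
  exact ⟨_, Measure.isAddLeftInvariant_eq_smul volume ((volume : Measure (J → ℂ)).map e)⟩

theorem integral_complex_exp_neg_mul_sq_norm {b : ℝ} (hb : 0 < b) :
    ∫ z : ℂ, Real.exp (-b * ‖z‖ ^ 2) = Real.pi / b := by
  rw [GaussianFourier.integral_rexp_neg_mul_sq_norm hb]
  simp

theorem integrable_complex_exp_neg_mul_sq_norm {b : ℝ} (hb : 0 < b) :
    Integrable fun z : ℂ => Real.exp (-b * ‖z‖ ^ 2) := by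
  -- An undefined Bochner integral is `0` by convention, whereas this one equals `π / b > 0`.
  by_contra h
  have := integral_complex_exp_neg_mul_sq_norm hb
  rw [integral_undef h] at this
  have : 0 < Real.pi / b := by positivity
  linarith

/-- The Gaussian integral of a diagonal quadratic form, up to a constant independent of the form. -/
theorem exists_lintegral_gaussian_eq (J : Type*) [Fintype J] :
    ∃ K : NNReal, ∀ c : J → ℝ, (∀ j, 0 < c j) →
      ∫⁻ x : EuclideanSpace ℂ J, ENNReal.ofReal (Real.exp (-∑ j, c j * ‖x j‖ ^ 2)) =
        K * ENNReal.ofReal (∏ j, c j)⁻¹ := by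
  obtain ⟨C, hC⟩ := exists_volume_euclidean_complex_eq J
  refine ⟨C * Real.toNNReal (Real.pi ^ Fintype.card J), fun c hc => ?_⟩
  have hm : Measurable fun x : EuclideanSpace ℂ J =>
      ENNReal.ofReal (Real.exp (-∑ j, c j * ‖x j‖ ^ 2)) := by fun_prop
  have hmeas : Measurable (WithLp.toLp 2 : (J → ℂ) → EuclideanSpace ℂ J) :=
    WithLp.measurable_toLp 2 _
  rw [hC, lintegral_smul_measure, lintegral_map hm hmeas]
  have hprod : ∀ y : J → ℂ, Real.exp (-∑ j, c j * ‖(WithLp.toLp 2 y : EuclideanSpace ℂ J) j‖ ^ 2) =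
      ∏ j, Real.exp (-c j * ‖y j‖ ^ 2) := by
    intro y
    rw [← Real.exp_sum, ← Finset.sum_neg_distrib]
    simp
  simp_rw [hprod]
  have hint : Integrable fun y : J → ℂ => ∏ j, Real.exp (-c j * ‖y j‖ ^ 2) :=
    Integrable.fintype_prod fun j => integrable_complex_exp_neg_mul_sq_norm (hc j)
  rw [← ofReal_integral_eq_lintegral_ofReal hint
    (Eventually.of_forall fun y => Finset.prod_nonneg fun j _ => (Real.exp_pos _).le)]
  have := integral_fintype_prod_eq_prod (𝕜 := ℝ) (μ := fun _ : J => (volume : Measure ℂ))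
    (fun j z => Real.exp (-c j * ‖z‖ ^ 2))
  rw [volume_pi, this]
  simp_rw [fun j => integral_complex_exp_neg_mul_sq_norm (hc j)]
  rw [Finset.prod_div_distrib, Finset.prod_const, Finset.card_univ, div_eq_mul_inv,
    ENNReal.ofReal_mul (by positivity), ENNReal.smul_def, smul_eq_mul, ENNReal.coe_mul, mul_assoc]
  rfl

/-- Chernoff's inequality for a quadratic form with eigenvalues `d j < 1` on the sphere. -/
theorem uniformSphere_quadratic_nonneg_le {I J : Type*} [Fintype I] [Fintype J] [Nonempty J]
    (U : EuclideanSpace ℂ J ≃ₗᵢ[ℝ] EuclideanSpace ℂ I) (d : I → ℝ) (hd : ∀ i, d i < 1) :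
    uniformSphere J {ψ | 0 ≤ ∑ i, d i * ‖U (ψ : EuclideanSpace ℂ J) i‖ ^ 2} ≤
      ENNReal.ofReal (∏ i, (1 - d i))⁻¹ := by
  obtain ⟨K, hK⟩ := exists_lintegral_gaussian_eq I
  let G : ℝ → ENNReal := fun r => ENNReal.ofReal (Real.exp (-r ^ 2))
  have hG : Measurable G := by fun_prop
  have hUc : Continuous U := U.continuous
  have hcont : ∀ i, Continuous fun x : EuclideanSpace ℂ J => U x i := fun i => by fun_prop
  let Φ : EuclideanSpace ℂ I → ENNReal := fun x =>
    ENNReal.ofReal (Real.exp (-∑ i, (1 - d i) * ‖x i‖ ^ 2))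
  have hA : MeasurableSet {ψ : Metric.sphere (0 : EuclideanSpace ℂ J) 1 |
      0 ≤ ∑ i, d i * ‖U (ψ : EuclideanSpace ℂ J) i‖ ^ 2} := by
    refine (isClosed_le continuous_const ?_).measurableSet
    exact continuous_finsetSum _ fun i _ => continuous_const.mul
      (((hcont i).comp continuous_subtype_val).norm.pow 2)
  -- The form is homogeneous, hence nonnegative on the whole cone over the event, where tilting the
  -- Gaussian by it only increases the density.
  have key := uniformSphere_mul_lintegral_le hA hG (F := fun x => Φ (U x)) (by
    intro ψ hψ r hr
    refine ENNReal.ofReal_le_ofReal (Real.exp_le_exp.2 ?_)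
    have h1 : ∑ i, ‖U (r • (ψ : EuclideanSpace ℂ J)) i‖ ^ 2 = r ^ 2 := by
      rw [← EuclideanSpace.norm_sq_eq, U.norm_map, norm_smul, norm_eq_of_mem_sphere ψ, mul_one,
        Real.norm_eq_abs, sq_abs]
    have h2 : ∑ i, d i * ‖U (r • (ψ : EuclideanSpace ℂ J)) i‖ ^ 2 =
        r ^ 2 * ∑ i, d i * ‖U (ψ : EuclideanSpace ℂ J) i‖ ^ 2 := by
      rw [Finset.mul_sum]
      refine Finset.sum_congr rfl fun i _ => ?_
      rw [map_smul, PiLp.smul_apply, norm_smul, Real.norm_eq_abs, mul_pow, sq_abs]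
      ring
    have h3 : 0 ≤ r ^ 2 * ∑ i, d i * ‖U (ψ : EuclideanSpace ℂ J) i‖ ^ 2 :=
      mul_nonneg (sq_nonneg r) hψ
    simp only [sub_mul, one_mul, Finset.sum_sub_distrib]
    linarith)
  have hmp := U.measurePreserving
  have hΦ : ∫⁻ x, Φ (U x) = K * ENNReal.ofReal (∏ i, (1 - d i))⁻¹ := by
    rw [← hK _ fun i => sub_pos.2 (hd i)]
    exact hmp.lintegral_comp_emb U.toHomeomorph.measurableEmbedding Φ
  have hGI : ∫⁻ x : EuclideanSpace ℂ J, G ‖x‖ = K := by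
    have h1 := hK (fun _ => 1) fun _ => one_pos
    simp only [Finset.prod_const_one, inv_one, ENNReal.ofReal_one, mul_one, one_mul,
      ← EuclideanSpace.norm_sq_eq] at h1
    rw [← h1, ← hmp.lintegral_comp_emb U.toHomeomorph.measurableEmbedding]
    simp [G]
  -- `K` is the Gaussian mass common to both sides; cancelling it needs `0 < K < ∞`.
  have hK0 : (K : ENNReal) ≠ 0 := by
    rw [← hGI, ← pos_iff_ne_zero, lintegral_pos_iff_support (by fun_prop)]
    have : Function.support (fun x : EuclideanSpace ℂ J => G ‖x‖) = Set.univ := by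
      ext x
      simp [G, Real.exp_pos]
    rw [this]
    exact IsOpen.measure_pos _ isOpen_univ Set.univ_nonempty
  rw [hΦ, hGI, mul_comm] at key
  exact (ENNReal.mul_le_mul_iff_right hK0 ENNReal.coe_ne_top).1 key

/-! ### Concentration and near isometry of contractions -/

section Contraction

variable {ι κ J : Type*} [Fintype ι] [Fintype κ]

/-- Contraction of a bipartite vector `x` with a vector of the first factor,
`u ↦ (∑ i, u i * conj (x (i, a)))_a`. -/
noncomputable def contraction (e : J ≃ ι × κ) (x : EuclideanSpace ℂ J) :
    EuclideanSpace ℂ ι →L[ℂ] EuclideanSpace ℂ κ :=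
  LinearMap.toContinuousLinearMap
    { toFun := fun u => WithLp.toLp 2 fun a => ∑ i, u i * star (x (e.symm (i, a)))
      map_add' := fun u v => by
        ext a
        simp [add_mul, Finset.sum_add_distrib]
      map_smul' := fun c u => by
        ext a
        simp [mul_assoc, Finset.mul_sum] }

theorem contraction_apply (e : J ≃ ι × κ) (x : EuclideanSpace ℂ J) (u : EuclideanSpace ℂ ι)
    (a : κ) : contraction e x u a = ∑ i, u i * star (x (e.symm (i, a))) := rfl

variable [Fintype J]

/-- The isometry expanding the first factor of a bipartite vector in an orthonormal basis. -/
theorem exists_isometry_contraction (e : J ≃ ι × κ)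
    (b : OrthonormalBasis ι ℂ (EuclideanSpace ℂ ι)) :
    ∃ U : EuclideanSpace ℂ J ≃ₗᵢ[ℝ] EuclideanSpace ℂ (ι × κ), ∀ x i a,
      ‖U x (i, a)‖ = ‖contraction e x (b i) a‖ := by
  let slice : EuclideanSpace ℂ J → κ → EuclideanSpace ℂ ι := fun x a =>
    WithLp.toLp 2 fun i => x (e.symm (i, a))
  -- The contraction is conjugate-linear in `x`; its complex conjugate is linear, with the same
  -- norms. Parseval in each slice makes it isometric.
  let L : EuclideanSpace ℂ J →ₗ[ℝ] EuclideanSpace ℂ (ι × κ) :=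
    { toFun := fun x => WithLp.toLp 2 fun p => inner ℂ (b p.1) (slice x p.2)
      map_add' := fun x y => by
        ext p
        have : slice (x + y) p.2 = slice x p.2 + slice y p.2 := by ext i; simp [slice]
        simp [this]
      map_smul' := fun c x => by
        ext p
        have : slice (c • x) p.2 = (c : ℂ) • slice x p.2 := by ext i; simp [slice]
        simp [this] }
  have hL : ∀ x, ‖L x‖ = ‖x‖ := by
    intro x
    rw [← sq_eq_sq₀ (norm_nonneg _) (norm_nonneg _), EuclideanSpace.norm_sq_eq,
      EuclideanSpace.norm_sq_eq, Fintype.sum_prod_type_right]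
    have h1 : ∀ a, ∑ i, ‖L x (i, a)‖ ^ 2 = ∑ i, ‖x (e.symm (i, a))‖ ^ 2 := by
      intro a
      have := b.sum_sq_norm_inner_right (slice x a)
      rw [EuclideanSpace.norm_sq_eq] at this
      exact this
    simp_rw [h1]
    rw [← Fintype.sum_prod_type_right (fun p => ‖x (e.symm p)‖ ^ 2)]
    exact e.symm.sum_comp fun j => ‖x j‖ ^ 2
  have hfin : Module.finrank ℝ (EuclideanSpace ℂ J) =
      Module.finrank ℝ (EuclideanSpace ℂ (ι × κ)) :=
    (LinearIsometryEquiv.piLpCongrLeft 2 ℝ ℂ e).toLinearEquiv.finrank_eq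
  refine ⟨LinearIsometry.toLinearIsometryEquiv ⟨L, hL⟩ hfin, fun x i a => ?_⟩
  have h2 : contraction e x (b i) a = star (L x (i, a)) := by
    rw [contraction_apply]
    change _ = star (inner ℂ (b i) (slice x a))
    rw [PiLp.inner_apply, star_sum]
    refine Finset.sum_congr rfl fun j _ => ?_
    simp [slice, mul_comm]
  rw [h2, norm_star]
  rfl

/-- With `y = δ(1 + δ) / (4n)`, one factor is `1 - δ/4 + y` and the other `n - 1` are `1 + y`.
Bernoulli bounds the latter below, the terms linear in `δ` cancel, and a quadratic gain remains for
either sign of `δ`. -/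
theorem le_prod_rank_one_perturbation [DecidableEq ι] [Nonempty ι] (i₀ : ι) {δ : ℝ}
    (hδ : |δ| ≤ 1 / 2) :
    1 + δ ^ 2 / 8 ≤
      ∏ i, (1 - δ / 4 * ((if i = i₀ then 1 else 0) - (1 + δ) / Fintype.card ι)) := by
  have hn : (1 : ℝ) ≤ Fintype.card ι := by exact_mod_cast Fintype.card_pos
  rw [← Finset.mul_prod_erase _ _ (Finset.mem_univ i₀),
    Finset.prod_congr rfl (g := fun _ => 1 + δ / 4 * (1 + δ) / Fintype.card ι) (by
      intro i hi
      rw [if_neg (Finset.ne_of_mem_erase hi)]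
      ring), Finset.prod_const, Finset.card_erase_of_mem (Finset.mem_univ _), Finset.card_univ,
    if_pos rfl]
  obtain ⟨h1, h2⟩ := abs_le.1 hδ
  set n : ℝ := ((Fintype.card ι : ℕ) : ℝ) with hndef
  set y := δ / 4 * (1 + δ) / n with hy
  have hyn : y * n = δ / 4 * (1 + δ) := by rw [hy]; field_simp
  have hyabs : |y| ≤ 1 / 4 := by
    rw [hy, abs_div, abs_of_pos (by linarith : (0 : ℝ) < n)]
    rw [div_le_iff₀ (by linarith)]
    have : |δ / 4 * (1 + δ)| ≤ 1 / 4 := by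
      rw [abs_le]; constructor <;> nlinarith
    linarith
  obtain ⟨h3, h4⟩ := abs_le.1 hyabs
  have hB := one_add_mul_le_pow (by linarith : -2 ≤ y) (Fintype.card ι - 1)
  rw [Nat.cast_pred Fintype.card_pos] at hB
  have h5 : 0 ≤ 1 - δ / 4 * (1 - (1 + δ) / n) := by
    have : δ / 4 * (1 - (1 + δ) / n) = δ / 4 - y := by rw [hy]; ring
    linarith
  refine le_trans ?_ (mul_le_mul_of_nonneg_left hB h5)
  have h6 : 1 - δ / 4 * (1 - (1 + δ) / n) = 1 - δ / 4 + y := by rw [hy]; ring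
  have h7 : 1 + (n - 1) * y = 1 + δ / 4 * (1 + δ) - y := by rw [← hyn]; ring
  rw [h6, show (1 : ℝ) + ((Fintype.card ι : ℝ) - 1) * y = 1 + δ / 4 * (1 + δ) - y from h7]
  -- The product expands to `1 + δ²/4 - δ²(1 + δ)/16` plus this term, and `|δ| ≤ 1/2` gives the
  -- bound.
  have h8 : 0 ≤ y * (δ / 4 * (1 + δ) + δ / 4 - y) := by
    have : y * (δ / 4 * (1 + δ) + δ / 4 - y) =
        δ ^ 2 / 16 * ((1 + δ) * (1 / n) * ((1 + δ) * (1 - 1 / n) + 1)) := by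
      rw [hy]; ring
    rw [this]
    have h9 : 1 / n ≤ 1 := by rw [div_le_one (by linarith)]; exact hn
    have h10 : 0 ≤ 1 - 1 / n := by linarith
    have h11 : 0 ≤ 1 + δ := by linarith
    positivity
  nlinarith [sq_nonneg δ]

/-- Concentration of the norm of the contraction with a fixed unit vector. -/
theorem uniformSphere_contraction_tail_le [Nonempty J] (e : J ≃ ι × κ) {δ : ℝ}
    (hδ : |δ| ≤ 1 / 2) (u : EuclideanSpace ℂ ι) (hu : ‖u‖ = 1) :
    uniformSphere J {ψ | 0 ≤ δ * (Fintype.card ι * ‖contraction e (ψ : EuclideanSpace ℂ J) u‖ ^ 2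
        - (1 + δ))} ≤ ENNReal.ofReal (((1 + δ ^ 2 / 8)⁻¹) ^ Fintype.card κ) := by
  classical
  obtain ⟨i₀, -⟩ : Nonempty (ι × κ) := e.nonempty_congr.1 inferInstance
  have : Nonempty ι := ⟨i₀⟩
  have hn : (1 : ℝ) ≤ Fintype.card ι := by exact_mod_cast Fintype.card_pos
  obtain ⟨b, hb⟩ := Orthonormal.exists_orthonormalBasis_extension_of_card_eq (𝕜 := ℂ)
    (E := EuclideanSpace ℂ ι) (ι := ι) finrank_euclideanSpace (v := fun _ => u) (s := {i₀}) (by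
      rw [orthonormal_iff_ite]
      rintro ⟨i, hi⟩ ⟨j, hj⟩
      obtain rfl : i = i₀ := hi
      obtain rfl : j = i := hj
      simp [Set.domRestrict, hu])
  have hb0 : b i₀ = u := hb i₀ rfl
  obtain ⟨U, hU⟩ := exists_isometry_contraction e b
  -- Since `‖ψ‖ = 1`, the threshold `1 + δ` can be absorbed into the quadratic form. The sign of `δ`
  -- selects the upper or lower tail; the scale `δ / 4` keeps `d < 1`.
  let d : ι × κ → ℝ := fun p =>
    δ / 4 * ((if p.1 = i₀ then 1 else 0) - (1 + δ) / Fintype.card ι)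
  have hd : ∀ p, d p < 1 := by
    intro p
    obtain ⟨h1, h2⟩ := abs_le.1 hδ
    have h3 : (1 + δ) / Fintype.card ι ≤ 3 / 2 := by
      rw [div_le_iff₀ (by linarith)]
      linarith
    have h4 : 0 ≤ (1 + δ) / Fintype.card ι := div_nonneg (by linarith) (by linarith)
    simp only [d]
    split_ifs <;> nlinarith
  refine le_trans (measure_mono ?_) ((uniformSphere_quadratic_nonneg_le U d hd).trans ?_)
  · intro ψ hψ
    simp only [Set.mem_ofPred_eq] at hψ ⊢
    have h1 : ∑ p : ι × κ, ‖U (ψ : EuclideanSpace ℂ J) p‖ ^ 2 = 1 := by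
      rw [← EuclideanSpace.norm_sq_eq, U.norm_map, norm_eq_of_mem_sphere ψ, one_pow]
    have h2 : ∑ p : ι × κ, (if p.1 = i₀ then (1 : ℝ) else 0) * ‖U (ψ : EuclideanSpace ℂ J) p‖ ^ 2 =
        ‖contraction e (ψ : EuclideanSpace ℂ J) u‖ ^ 2 := by
      rw [Fintype.sum_prod_type, EuclideanSpace.norm_sq_eq, ← hb0]
      simp only [ite_mul, one_mul, zero_mul]
      rw [Finset.sum_eq_single i₀]
      · simp [hU]
      · intro i _ hi
        simp [hi]
      · simp
    have h3 : ∑ p, d p * ‖U (ψ : EuclideanSpace ℂ J) p‖ ^ 2 =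
        δ / 4 * (‖contraction e (ψ : EuclideanSpace ℂ J) u‖ ^ 2 - (1 + δ) / Fintype.card ι) := by
      simp only [d, mul_assoc, sub_mul, ← Finset.mul_sum, Finset.sum_sub_distrib]
      rw [h1, h2, mul_one]
    rw [h3]
    have h4 : δ / 4 * (‖contraction e (ψ : EuclideanSpace ℂ J) u‖ ^ 2 - (1 + δ) / Fintype.card ι) =
        δ * (Fintype.card ι * ‖contraction e (ψ : EuclideanSpace ℂ J) u‖ ^ 2 - (1 + δ)) /
          (4 * Fintype.card ι) := by
      field_simp
    rw [h4]
    positivity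
  · refine ENNReal.ofReal_le_ofReal ?_
    rw [Fintype.prod_prod_type]
    change (∏ i, ∏ _a : κ,
      (1 - δ / 4 * ((if i = i₀ then 1 else 0) - (1 + δ) / Fintype.card ι)))⁻¹ ≤ _
    simp_rw [Finset.prod_const]
    rw [Finset.prod_pow, Finset.card_univ, inv_pow]
    have := le_prod_rank_one_perturbation i₀ hδ
    gcongr

/-- All contractions of `x` with unit vectors of the first factor have norm close to
`(card ι)^(-1/2)`. -/
def NearlyIsometric (e : J ≃ ι × κ) (ε : ℝ) (x : EuclideanSpace ℂ J) : Prop :=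
  ∀ u : EuclideanSpace ℂ ι, (1 - ε) * ‖u‖ ≤ √(Fintype.card ι) * ‖contraction e x u‖ ∧
    √(Fintype.card ι) * ‖contraction e x u‖ ≤ (1 + ε) * ‖u‖

/-- The contraction map of a uniform unit vector is nearly isometric, up to scaling, with large
probability. -/
theorem uniformSphere_not_nearlyIsometric_le [Nonempty J] (e : J ≃ ι × κ) {ε : ℝ} (hε : 0 < ε)
    (hε1 : ε ≤ 1) :
    uniformSphere J {ψ | ¬ NearlyIsometric e ε (ψ : EuclideanSpace ℂ J)} ≤
      ENNReal.ofReal (2 * ((1 + 8 / ε) ^ (2 * Fintype.card ι) *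
        ((1 + (ε / 4) ^ 2 / 8)⁻¹) ^ Fintype.card κ)) := by
  -- `ε / 4` is both the mesh and the deviation allowed at net points; as `ε ≤ 1`, extending from
  -- the net to all vectors costs no more than `ε` in total.
  obtain ⟨S, hS1, hS2, hS3⟩ := exists_net_sphere (EuclideanSpace ℂ ι) (by positivity : 0 < ε / 4)
  have hfin : Module.finrank ℝ (EuclideanSpace ℂ ι) = 2 * Fintype.card ι := by
    rw [finrank_real_of_complex, finrank_euclideanSpace]
  set q := ((1 + (ε / 4) ^ 2 / 8)⁻¹) ^ Fintype.card κ with hq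
  have hq0 : 0 ≤ q := by positivity
  let B : ℝ → EuclideanSpace ℂ ι → Set (Metric.sphere (0 : EuclideanSpace ℂ J) 1) := fun δ u =>
    {ψ | 0 ≤ δ * (Fintype.card ι * ‖contraction e (ψ : EuclideanSpace ℂ J) u‖ ^ 2 - (1 + δ))}
  have hsub : {ψ : Metric.sphere (0 : EuclideanSpace ℂ J) 1 |
      ¬ NearlyIsometric e ε (ψ : EuclideanSpace ℂ J)} ⊆
      ⋃ v ∈ S, (B (ε / 4) v ∪ B (-(ε / 4)) v) := by
    intro ψ hψ
    contrapose! hψ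
    simp only [B, Set.mem_iUnion, Set.mem_union, Set.mem_ofPred_eq, not_exists, not_or, not_le] at hψ
    simp only [Set.mem_ofPred_eq, not_not]
    set T : EuclideanSpace ℂ ι →L[ℂ] EuclideanSpace ℂ κ :=
      ((√(Fintype.card ι) : ℝ) : ℂ) • contraction e (ψ : EuclideanSpace ℂ J) with hT
    have hTn : ∀ u, ‖T u‖ = √(Fintype.card ι) * ‖contraction e (ψ : EuclideanSpace ℂ J) u‖ := by
      intro u
      rw [hT, smul_apply, norm_smul, Complex.norm_real, Real.norm_eq_abs,
        abs_of_nonneg (Real.sqrt_nonneg _)]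
    have hTsq : ∀ u, Fintype.card ι * ‖contraction e (ψ : EuclideanSpace ℂ J) u‖ ^ 2 =
        ‖T u‖ ^ 2 := by
      intro u
      rw [hTn, mul_pow, Real.sq_sqrt (Nat.cast_nonneg _)]
    have hv : ∀ v ∈ S, 1 - ε / 4 ≤ ‖T v‖ ∧ ‖T v‖ ≤ 1 + ε / 4 := by
      intro v hvS
      obtain ⟨h1, h2⟩ := hψ v hvS
      rw [hTsq] at h1 h2
      have h3 : ‖T v‖ ^ 2 < 1 + ε / 4 := by nlinarith
      have h4 : 1 - ε / 4 < ‖T v‖ ^ 2 := by nlinarith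
      constructor
      · refine (pow_le_pow_iff_left₀ (by linarith) (norm_nonneg _) two_ne_zero).1 ?_
        nlinarith
      · refine (pow_le_pow_iff_left₀ (norm_nonneg _) (by linarith) two_ne_zero).1 ?_
        nlinarith
    intro u
    have hb := norm_bounds_of_net T S (by linarith : 0 ≤ ε / 4) (by linarith) hS2
      (by linarith : 0 ≤ 1 + ε / 4) (fun v hvS => (hv v hvS).1) (fun v hvS => (hv v hvS).2) u
    have hratio : (1 + ε / 4) / (1 - ε / 4) ≤ 1 + ε := by
      rw [div_le_iff₀ (by linarith)]
      nlinarith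
    rw [← hTn]
    constructor
    · refine le_trans (mul_le_mul_of_nonneg_right ?_ (norm_nonneg u)) hb.1
      nlinarith
    · exact hb.2.trans (mul_le_mul_of_nonneg_right hratio (norm_nonneg u))
  have habs : |ε / 4| ≤ 1 / 2 := by rw [abs_of_pos (by positivity)]; linarith
  calc _ ≤ uniformSphere J (⋃ v ∈ S, (B (ε / 4) v ∪ B (-(ε / 4)) v)) := measure_mono hsub
    _ ≤ ∑ v ∈ S, uniformSphere J (B (ε / 4) v ∪ B (-(ε / 4)) v) := measure_biUnion_finset_le _ _
    _ ≤ ∑ v ∈ S, ENNReal.ofReal (2 * q) := by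
        refine Finset.sum_le_sum fun v hvS => (measure_union_le _ _).trans ?_
        rw [two_mul, ENNReal.ofReal_add hq0 hq0]
        refine add_le_add (uniformSphere_contraction_tail_le e habs v (hS1 v hvS)) ?_
        have := uniformSphere_contraction_tail_le e (δ := -(ε / 4)) (by rwa [abs_neg]) v (hS1 v hvS)
        rwa [neg_sq] at this
    _ = ENNReal.ofReal (S.card * (2 * q)) := by
        rw [Finset.sum_const, nsmul_eq_mul, ENNReal.ofReal_mul (Nat.cast_nonneg _),
          ENNReal.ofReal_natCast]
    _ ≤ _ := by
        refine ENNReal.ofReal_le_ofReal ?_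
        rw [hfin, show 2 / (ε / 4) = 8 / ε by field_simp; norm_num] at hS3
        nlinarith

end Contraction

/-! ### Entropy against decay -/

/-- An exponential growth of order `a` is beaten by an exponential decay of order `b ≫ a`. -/
theorem tendsto_const_pow_mul_pow {C q : ℝ} (hC : 0 < C) (hq0 : 0 < q) (hq1 : q < 1) {a b : ℕ → ℕ}
    (ha : Tendsto (fun n => (a n : ℝ)) atTop atTop)
    (hab : Tendsto (fun n => (b n : ℝ) / a n) atTop atTop) :
    Tendsto (fun n => ENNReal.ofReal (2 * (C ^ (2 * a n) * q ^ b n))) atTop (𝓝 0) := by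
  rw [← ENNReal.ofReal_zero]
  refine ENNReal.tendsto_ofReal ?_
  suffices h : Tendsto (fun n => C ^ (2 * a n) * q ^ b n) atTop (𝓝 0) by
    simpa using h.const_mul 2
  have hlog : Real.log q < 0 := Real.log_neg hq0 hq1
  have h1 : Tendsto (fun n => (a n : ℝ) * (2 * Real.log C + (b n : ℝ) / a n * Real.log q))
      atTop atBot :=
    ha.atTop_mul_atBot₀ (tendsto_atBot_add_const_left _ _ (hab.atTop_mul_const_of_neg hlog))
  refine (Real.tendsto_exp_atBot.comp h1).congr' ?_
  filter_upwards [ha.eventually_gt_atTop 0] with n hn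
  have : (a n : ℝ) * (2 * Real.log C + (b n : ℝ) / a n * Real.log q) =
      (2 * a n : ℕ) * Real.log C + (b n : ℕ) * Real.log q := by
    push_cast
    field_simp
  rw [Function.comp_apply, this, Real.exp_add, Real.exp_nat_mul, Real.exp_nat_mul,
    Real.exp_log hC, Real.exp_log hq0]

/-! ### The reduction criterion as a comparison of quadratic forms -/

section Reduction

variable {ι κ σ : Type*} [Fintype ι] [Fintype κ] [Fintype σ]

/-- The vector `(∑ p, v p * conj (ψ (p, t)))_t`, whose squared norm is `⟨v, Tr(ψψ*) v⟩`. -/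
noncomputable def environmentVector {τ : Type*} [Fintype τ] (ψ : EuclideanSpace ℂ (τ × σ))
    (v : τ → ℂ) : EuclideanSpace ℂ σ :=
  WithLp.toLp 2 fun t => ∑ p, v p * star (ψ (p, t))

theorem dotProduct_partialTrace_pureState {τ : Type*} [Fintype τ] (ψ : EuclideanSpace ℂ (τ × σ))
    (v : τ → ℂ) :
    star v ⬝ᵥ (partialTrace (pureState ψ)).mulVec v =
      ((‖environmentVector ψ v‖ ^ 2 : ℝ) : ℂ) := by
  have h : ∀ t, ((‖environmentVector ψ v t‖ ^ 2 : ℝ) : ℂ) =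
      ∑ p, ∑ q, star (v p) * (ψ (p, t) * star (ψ (q, t)) * v q) := by
    intro t
    rw [Complex.ofReal_pow, ← Complex.conj_mul']
    simp only [environmentVector, map_sum, Finset.sum_mul_sum, map_mul, Complex.star_def,
      Complex.conj_conj]
    exact Finset.sum_congr rfl fun p _ => Finset.sum_congr rfl fun q _ => by ring
  rw [EuclideanSpace.norm_sq_eq, Complex.ofReal_sum]
  simp_rw [h]
  rw [Finset.sum_comm]
  simp only [dotProduct, Matrix.mulVec, partialTrace, pureState, Matrix.of_apply, Pi.star_apply,
    Finset.sum_mul, Finset.mul_sum]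
  exact Finset.sum_congr rfl fun p _ => Finset.sum_comm

/-- The identity on `κ` decouples the slices `v (·, b)`. Each is tested against the marginal on `ι`,
for which `κ` and `σ` together form the environment. -/
theorem dotProduct_partialTrace_kronecker_one [DecidableEq κ]
    (ψ : EuclideanSpace ℂ ((ι × κ) × σ)) (v : ι × κ → ℂ) :
    star v ⬝ᵥ (partialTrace (partialTrace (pureState ψ)) ⊗ₖ (1 : Matrix κ κ ℂ)).mulVec v =
      ((∑ b, ‖contraction (Equiv.prodAssoc ι κ σ) ψ (WithLp.toLp 2 fun i => v (i, b))‖ ^ 2 : ℝ) :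
        ℂ) := by
  have h : ∀ b (p : κ × σ), ((‖contraction (Equiv.prodAssoc ι κ σ) ψ
      (WithLp.toLp 2 fun i => v (i, b)) p‖ ^ 2 : ℝ) : ℂ) =
      ∑ i, ∑ j, star (v (i, b)) * (ψ ((i, p.1), p.2) * star (ψ ((j, p.1), p.2)) * v (j, b)) := by
    intro b p
    rw [Complex.ofReal_pow, ← Complex.conj_mul']
    simp only [contraction_apply, map_sum, Finset.sum_mul_sum, map_mul, Complex.star_def,
      Complex.conj_conj, Equiv.prodAssoc_symm_apply]
    exact Finset.sum_congr rfl fun p _ => Finset.sum_congr rfl fun q _ => by ring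
  simp_rw [EuclideanSpace.norm_sq_eq, Complex.ofReal_sum, h]
  simp only [dotProduct, Matrix.mulVec, partialTrace, pureState, Matrix.of_apply, Pi.star_apply,
    Matrix.kroneckerMap_apply, Matrix.one_apply, mul_ite, mul_one, mul_zero, ite_mul, zero_mul]
  rw [Fintype.sum_prod_type_right]
  refine Finset.sum_congr rfl fun b _ => ?_
  rw [Finset.sum_comm]
  refine Finset.sum_congr rfl fun i _ => ?_
  rw [Finset.sum_comm, Fintype.sum_prod_type, Finset.mul_sum]
  refine Finset.sum_congr rfl fun j _ => ?_
  simp only [Finset.sum_ite_eq, Finset.mem_univ, if_true]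
  rw [Fintype.sum_prod_type, Finset.sum_mul, Finset.mul_sum]
  refine Finset.sum_congr rfl fun a _ => ?_
  rw [Finset.sum_mul, Finset.mul_sum]

theorem dotProduct_reduction [DecidableEq κ] (ψ : EuclideanSpace ℂ ((ι × κ) × σ))
    (v : ι × κ → ℂ) :
    star v ⬝ᵥ (reduction (partialTrace (pureState ψ))).mulVec v =
      ((∑ b, ‖contraction (Equiv.prodAssoc ι κ σ) ψ (WithLp.toLp 2 fun i => v (i, b))‖ ^ 2 -
        ‖environmentVector ψ v‖ ^ 2 : ℝ) : ℂ) := by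
  rw [reduction, Matrix.sub_mulVec, dotProduct_sub, dotProduct_partialTrace_kronecker_one,
    dotProduct_partialTrace_pureState, Complex.ofReal_sub]

theorem isHermitian_partialTrace_pureState {τ : Type*} (ψ : EuclideanSpace ℂ (τ × σ)) :
    (partialTrace (pureState ψ)).IsHermitian := by
  ext p q
  simp [partialTrace, pureState, mul_comm]

theorem isHermitian_partialTrace {ι κ : Type*} [Fintype κ] {X : Matrix (ι × κ) (ι × κ) ℂ} (hX : X.IsHermitian) :
    (partialTrace X).IsHermitian := by
  ext i j
  simp only [partialTrace, Matrix.conjTranspose_apply, Matrix.of_apply, star_sum]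
  exact Finset.sum_congr rfl fun a _ => hX.apply _ _

theorem isHermitian_reduction {ι κ : Type*} [Fintype κ] [DecidableEq κ] {X : Matrix (ι × κ) (ι × κ) ℂ}
    (hX : X.IsHermitian) : (reduction X).IsHermitian := by
  refine Matrix.IsHermitian.sub ?_ hX
  rw [Matrix.IsHermitian, Matrix.conjTranspose_kronecker, Matrix.conjTranspose_one,
    isHermitian_partialTrace hX]

/-- Positive reduction of an induced state as a comparison of two quadratic forms. -/
theorem hasPositiveReduction_iff [DecidableEq κ] (ψ : EuclideanSpace ℂ ((ι × κ) × σ)) :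
    HasPositiveReduction (partialTrace (pureState ψ)) ↔ ∀ v : ι × κ → ℂ,
      ‖environmentVector ψ v‖ ^ 2 ≤
        ∑ b, ‖contraction (Equiv.prodAssoc ι κ σ) ψ (WithLp.toLp 2 fun i => v (i, b))‖ ^ 2 := by
  constructor
  · intro h v
    have := Matrix.PosSemidef.dotProduct_mulVec_nonneg h v
    rw [dotProduct_reduction, Complex.zero_le_real] at this
    linarith
  · intro h
    refine Matrix.PosSemidef.of_dotProduct_mulVec_nonneg
      (isHermitian_reduction (isHermitian_partialTrace_pureState ψ)) fun v => ?_
    rw [dotProduct_reduction, Complex.zero_le_real]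
    linarith [h v]

theorem sum_norm_sq_slice (v : ι × κ → ℂ) :
    ∑ b, ‖(WithLp.toLp 2 fun i => v (i, b) : EuclideanSpace ℂ ι)‖ ^ 2 =
      ‖(WithLp.toLp 2 v : EuclideanSpace ℂ (ι × κ))‖ ^ 2 := by
  simp_rw [EuclideanSpace.norm_sq_eq]
  rw [Fintype.sum_prod_type_right]

theorem NearlyIsometric.sq_bounds {J : Type*} {e : J ≃ ι × κ} {ε : ℝ} {x : EuclideanSpace ℂ J}
    (h : NearlyIsometric e ε x) (hε : 0 ≤ ε) (hε1 : ε ≤ 1) (u : EuclideanSpace ℂ ι) :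
    (1 - ε) ^ 2 * ‖u‖ ^ 2 ≤ Fintype.card ι * ‖contraction e x u‖ ^ 2 ∧
      Fintype.card ι * ‖contraction e x u‖ ^ 2 ≤ (1 + ε) ^ 2 * ‖u‖ ^ 2 := by
  obtain ⟨h1, h2⟩ := h u
  have h3 : Fintype.card ι * ‖contraction e x u‖ ^ 2 =
      (√(Fintype.card ι) * ‖contraction e x u‖) ^ 2 := by
    rw [mul_pow, Real.sq_sqrt (Nat.cast_nonneg _)]
  rw [h3, ← mul_pow, ← mul_pow]
  exact ⟨pow_le_pow_left₀ (mul_nonneg (by linarith) (norm_nonneg u)) h1 2,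
    pow_le_pow_left₀ (by positivity) h2 2⟩

/-- Duality: up to conjugations `environmentVector ψ` is the adjoint of the contraction out of `σ`,
so it inherits the upper bound by Cauchy–Schwarz. -/
theorem NearlyIsometric.environmentVector_le {τ : Type*} [Fintype τ]
    {ψ : EuclideanSpace ℂ (τ × σ)} {ε : ℝ} (h : NearlyIsometric (Equiv.prodComm τ σ) ε ψ)
    (hε : 0 ≤ ε) (hε1 : ε ≤ 1) (v : τ → ℂ) :
    Fintype.card σ * ‖environmentVector ψ v‖ ^ 2 ≤
      (1 + ε) ^ 2 * ‖(WithLp.toLp 2 v : EuclideanSpace ℂ τ)‖ ^ 2 := by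
  set y := environmentVector ψ v with hy
  let w : EuclideanSpace ℂ σ := WithLp.toLp 2 fun t => star (y t)
  let z := contraction (Equiv.prodComm τ σ) ψ w
  have hw : ‖w‖ = ‖y‖ := by
    simp [EuclideanSpace.norm_eq, w]
  have hinner : inner ℂ (WithLp.toLp 2 (star v) : EuclideanSpace ℂ τ) z = ((‖y‖ ^ 2 : ℝ) : ℂ) := by
    rw [PiLp.inner_apply, EuclideanSpace.norm_sq_eq, Complex.ofReal_sum]
    have h1 : ∀ t, ((‖y t‖ ^ 2 : ℝ) : ℂ) = ∑ p, star (y t) * (v p * star (ψ (p, t))) := by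
      intro t
      rw [Complex.ofReal_pow, ← Complex.conj_mul', ← Finset.mul_sum]
      rfl
    simp_rw [h1]
    rw [Finset.sum_comm]
    refine Finset.sum_congr rfl fun p _ => ?_
    simp only [z, w, contraction_apply, RCLike.inner_apply, Finset.sum_mul, Pi.star_apply,
      Complex.star_def, Complex.conj_conj, Equiv.prodComm_symm, Equiv.prodComm_apply,
      Prod.swap_prod_mk]
    exact Finset.sum_congr rfl fun t _ => by ring
  have hcs : ‖y‖ ^ 2 ≤ ‖(WithLp.toLp 2 v : EuclideanSpace ℂ τ)‖ * ‖z‖ := by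
    have h1 := norm_inner_le_norm (𝕜 := ℂ) (WithLp.toLp 2 (star v) : EuclideanSpace ℂ τ) z
    rw [hinner, Complex.norm_real, Real.norm_of_nonneg (by positivity)] at h1
    have h2 : ‖(WithLp.toLp 2 (star v) : EuclideanSpace ℂ τ)‖ =
        ‖(WithLp.toLp 2 v : EuclideanSpace ℂ τ)‖ := by
      simp [EuclideanSpace.norm_eq]
    rwa [h2] at h1
  have hz := (h.sq_bounds hε hε1 w).2
  rw [hw] at hz
  rcases (norm_nonneg y).eq_or_lt with h0 | h0
  · rw [← h0]
    simp only [ne_eq, OfNat.ofNat_ne_zero, not_false_eq_true, zero_pow, mul_zero]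
    positivity
  have hsq : (‖y‖ ^ 2) ^ 2 ≤ (‖(WithLp.toLp 2 v : EuclideanSpace ℂ τ)‖ * ‖z‖) ^ 2 :=
    pow_le_pow_left₀ (by positivity) hcs 2
  refine le_of_mul_le_mul_right ?_ (pow_pos h0 2)
  calc Fintype.card σ * ‖y‖ ^ 2 * ‖y‖ ^ 2 = Fintype.card σ * (‖y‖ ^ 2) ^ 2 := by ring
    _ ≤ Fintype.card σ * (‖(WithLp.toLp 2 v : EuclideanSpace ℂ τ)‖ * ‖z‖) ^ 2 := by gcongr
    _ = ‖(WithLp.toLp 2 v : EuclideanSpace ℂ τ)‖ ^ 2 * (Fintype.card σ * ‖z‖ ^ 2) := by ring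
    _ ≤ ‖(WithLp.toLp 2 v : EuclideanSpace ℂ τ)‖ ^ 2 * ((1 + ε) ^ 2 * ‖y‖ ^ 2) := by gcongr
    _ = _ := by ring

/-- The adjoint may have a kernel, so no lower bound holds for every `v`. A vector in the range of
the contraction works, up to conjugation: for `v = ψ (·, t)`, coordinate `t` of the environment
vector is already `‖v‖²`, which is at least `(1 - ε)² / s`. -/
theorem NearlyIsometric.exists_le_environmentVector {τ : Type*} [Fintype τ] [Nonempty σ]
    {ψ : EuclideanSpace ℂ (τ × σ)} {ε : ℝ} (h : NearlyIsometric (Equiv.prodComm τ σ) ε ψ)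
    (hε : 0 ≤ ε) (hε1 : ε < 1) :
    ∃ v : τ → ℂ, 0 < ‖(WithLp.toLp 2 v : EuclideanSpace ℂ τ)‖ ∧
      (1 - ε) ^ 2 * ‖(WithLp.toLp 2 v : EuclideanSpace ℂ τ)‖ ^ 2 ≤
        Fintype.card σ * ‖environmentVector ψ v‖ ^ 2 := by
  classical
  obtain ⟨t⟩ := ‹Nonempty σ›
  let v : τ → ℂ := fun p => ψ (p, t)
  let w : EuclideanSpace ℂ σ := EuclideanSpace.single t 1
  have hz : ‖contraction (Equiv.prodComm τ σ) ψ w‖ = ‖(WithLp.toLp 2 v : EuclideanSpace ℂ τ)‖ := by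
    simp [EuclideanSpace.norm_eq, contraction_apply, w, v]
  have hb := (h.sq_bounds hε hε1.le w).1
  rw [hz] at hb
  have hw : ‖w‖ = 1 := by simp [w]
  rw [hw, one_pow, mul_one] at hb
  have hy : ‖(WithLp.toLp 2 v : EuclideanSpace ℂ τ)‖ ^ 2 ≤ ‖environmentVector ψ v‖ := by
    refine le_trans (le_of_eq ?_) (PiLp.norm_apply_le (environmentVector ψ v) t)
    have : environmentVector ψ v t =
        ((‖(WithLp.toLp 2 v : EuclideanSpace ℂ τ)‖ ^ 2 : ℝ) : ℂ) := by
      rw [EuclideanSpace.norm_sq_eq, Complex.ofReal_sum]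
      refine Finset.sum_congr rfl fun p _ => ?_
      rw [Complex.ofReal_pow, ← Complex.mul_conj']
      rfl
    rw [this, Complex.norm_real, Real.norm_of_nonneg (by positivity)]
  have h1 : 0 < (1 - ε) ^ 2 := pow_pos (by linarith) 2
  refine ⟨v, (norm_nonneg _).lt_of_ne fun h0 => ?_, ?_⟩
  · rw [← h0] at hb
    norm_num at hb
    linarith
  · set V := ‖(WithLp.toLp 2 v : EuclideanSpace ℂ τ)‖
    calc (1 - ε) ^ 2 * V ^ 2 ≤ Fintype.card σ * V ^ 2 * V ^ 2 := by gcongr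
      _ = Fintype.card σ * (V ^ 2) ^ 2 := by ring
      _ ≤ _ := by gcongr

/-- Here `ρ ≤ (1 + ε)² / s` and `ρ_A ⊗ I ≥ (1 - ε)² / n`, so comparing scalars suffices. -/
theorem hasPositiveReduction_of_nearlyIsometric [DecidableEq κ] [Nonempty ι] [Nonempty σ]
    {ψ : EuclideanSpace ℂ ((ι × κ) × σ)} {ε : ℝ} (hε : 0 ≤ ε) (hε1 : ε ≤ 1)
    (hA : NearlyIsometric (Equiv.prodAssoc ι κ σ) ε ψ)
    (hB : NearlyIsometric (Equiv.prodComm (ι × κ) σ) ε ψ)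
    (h : Fintype.card ι * (1 + ε) ^ 2 ≤ Fintype.card σ * (1 - ε) ^ 2) :
    HasPositiveReduction (partialTrace (pureState ψ)) := by
  rw [hasPositiveReduction_iff]
  intro v
  have hn : (0 : ℝ) < Fintype.card ι := by exact_mod_cast Fintype.card_pos
  have hs : (0 : ℝ) < Fintype.card σ := by exact_mod_cast Fintype.card_pos
  have h1 := hB.environmentVector_le hε hε1 v
  have h2 := Finset.sum_le_sum fun b (_ : b ∈ Finset.univ) =>
    (hA.sq_bounds hε hε1 (WithLp.toLp 2 fun i => v (i, b))).1
  rw [← Finset.mul_sum, ← Finset.mul_sum, sum_norm_sq_slice] at h2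
  refine le_of_mul_le_mul_left ?_ (mul_pos hn hs)
  set V := ‖(WithLp.toLp 2 v : EuclideanSpace ℂ (ι × κ))‖
  calc Fintype.card ι * Fintype.card σ * ‖environmentVector ψ v‖ ^ 2
      = Fintype.card ι * (Fintype.card σ * ‖environmentVector ψ v‖ ^ 2) := by ring
    _ ≤ Fintype.card ι * ((1 + ε) ^ 2 * V ^ 2) := by gcongr
    _ = Fintype.card ι * (1 + ε) ^ 2 * V ^ 2 := by ring
    _ ≤ Fintype.card σ * (1 - ε) ^ 2 * V ^ 2 := by gcongr
    _ = Fintype.card σ * ((1 - ε) ^ 2 * V ^ 2) := by ring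
    _ ≤ _ := by
      rw [mul_comm (Fintype.card ι : ℝ), mul_assoc]
      gcongr

/-- A single direction where `ρ` reaches `(1 - ε)² / s` beats the uniform bound `ρ_A ⊗ I ≤ (1 + ε)²
/ n`. -/
theorem not_hasPositiveReduction_of_nearlyIsometric [DecidableEq κ] [Nonempty σ]
    {ψ : EuclideanSpace ℂ ((ι × κ) × σ)} {ε : ℝ} (hε : 0 ≤ ε) (hε1 : ε < 1)
    (hA : NearlyIsometric (Equiv.prodAssoc ι κ σ) ε ψ)
    (hB : NearlyIsometric (Equiv.prodComm (ι × κ) σ) ε ψ)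
    (h : Fintype.card σ * (1 + ε) ^ 2 < Fintype.card ι * (1 - ε) ^ 2) :
    ¬ HasPositiveReduction (partialTrace (pureState ψ)) := by
  rw [hasPositiveReduction_iff]
  intro hpos
  obtain ⟨v, hv0, hv⟩ := hB.exists_le_environmentVector hε hε1
  have h1 := hpos v
  have h2 := Finset.sum_le_sum fun b (_ : b ∈ Finset.univ) =>
    (hA.sq_bounds hε hε1.le (WithLp.toLp 2 fun i => v (i, b))).2
  rw [← Finset.mul_sum, ← Finset.mul_sum, sum_norm_sq_slice] at h2
  set V := ‖(WithLp.toLp 2 v : EuclideanSpace ℂ (ι × κ))‖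
  refine absurd ?_ (not_le.2 (mul_lt_mul_of_pos_right h (pow_pos hv0 2)))
  calc Fintype.card ι * (1 - ε) ^ 2 * V ^ 2 = Fintype.card ι * ((1 - ε) ^ 2 * V ^ 2) := by ring
    _ ≤ Fintype.card ι * (Fintype.card σ * ‖environmentVector ψ v‖ ^ 2) := by gcongr
    _ ≤ Fintype.card ι * (Fintype.card σ * ∑ b, ‖contraction (Equiv.prodAssoc ι κ σ) ψ
          (WithLp.toLp 2 fun i => v (i, b))‖ ^ 2) := by gcongr
    _ = Fintype.card σ * (Fintype.card ι * ∑ b, ‖contraction (Equiv.prodAssoc ι κ σ) ψ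
          (WithLp.toLp 2 fun i => v (i, b))‖ ^ 2) := by ring
    _ ≤ Fintype.card σ * ((1 + ε) ^ 2 * V ^ 2) := by gcongr
    _ = _ := by ring

/-- There are uncountably many test vectors, but each condition is closed in `X`, hence so is their
intersection. -/
theorem measurableSet_hasPositiveReduction [DecidableEq κ] :
    MeasurableSet {X : Matrix (ι × κ) (ι × κ) ℂ | HasPositiveReduction X} := by
  have : BorelSpace (Matrix (ι × κ) (ι × κ) ℂ) :=
    inferInstanceAs (BorelSpace (ι × κ → ι × κ → ℂ))
  have hred : Continuous fun X : Matrix (ι × κ) (ι × κ) ℂ => reduction X := by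
    refine continuous_matrix fun p q => ?_
    simp only [reduction, partialTrace, Matrix.sub_apply, Matrix.kroneckerMap_apply,
      Matrix.of_apply]
    fun_prop
  have heq : {X : Matrix (ι × κ) (ι × κ) ℂ | HasPositiveReduction X} =
      {X | (reduction X).conjTranspose = reduction X} ∩
        ⋂ v : ι × κ → ℂ, {X | 0 ≤ star v ⬝ᵥ (reduction X).mulVec v} := by
    ext X
    simp only [Set.mem_inter_iff, Set.mem_iInter, Set.mem_ofPred_eq]
    exact ⟨fun h => ⟨h.isHermitian, fun v => Matrix.PosSemidef.dotProduct_mulVec_nonneg h v⟩,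
      fun h => Matrix.PosSemidef.of_dotProduct_mulVec_nonneg h.1 h.2⟩
  rw [heq]
  refine (IsClosed.inter (isClosed_eq hred.matrix_conjTranspose hred)
    (isClosed_iInter fun v => isClosed_le continuous_const ?_)).measurableSet
  exact continuous_const.dotProduct (hred.matrix_mulVec continuous_const)

theorem inducedMeasure_hasPositiveReduction [DecidableEq κ] :
    inducedMeasure (ι × κ) σ {X | HasPositiveReduction X} =
      uniformSphere ((ι × κ) × σ) {ψ | HasPositiveReduction
        (partialTrace (pureState (ψ : EuclideanSpace ℂ ((ι × κ) × σ))))} := by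
  rw [inducedMeasure, Measure.map_apply ?_ measurableSet_hasPositiveReduction]
  · rfl
  · refine measurable_pi_lambda _ fun p => measurable_pi_lambda _ fun q => ?_
    simp only [partialTrace, pureState, Matrix.of_apply]
    refine Continuous.measurable ?_
    fun_prop

end Reduction

/-! ### Asymptotics and the threshold -/

/-- Both marginals of a uniform unit vector on `(ℂⁿ ⊗ ℂᵏ) ⊗ ℂˢ` that enter the reduction criterion
are asymptotically flat. -/
theorem tendsto_uniformSphere_not_nearlyIsometric {k s : ℕ → ℕ} {c ε : ℝ} (hc : 0 < c)
    (hε : 0 < ε) (hε1 : ε ≤ 1) (hk : Tendsto k atTop atTop)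
    (hs : Tendsto (fun n => (s n : ℝ) / n) atTop (𝓝 c)) :
    Tendsto (fun n => uniformSphere ((Fin n × Fin (k n)) × Fin (s n))
      {ψ | ¬ (NearlyIsometric (Equiv.prodAssoc _ _ _) ε ψ.1 ∧
        NearlyIsometric (Equiv.prodComm _ _) ε ψ.1)}) atTop (𝓝 0) := by
  have hkR : Tendsto (fun n => (k n : ℝ)) atTop atTop := tendsto_natCast_atTop_atTop.comp hk
  have hn : Tendsto (fun n : ℕ => (n : ℝ)) atTop atTop := tendsto_natCast_atTop_atTop
  have hsR : Tendsto (fun n => (s n : ℝ)) atTop atTop := by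
    refine (hs.pos_mul_atTop hc hn).congr' ?_
    filter_upwards [eventually_gt_atTop 0] with n hn0
    field_simp
  have hC : 0 < 1 + 8 / ε := by positivity
  have hq0 : 0 < (1 + (ε / 4) ^ 2 / 8)⁻¹ := by positivity
  have hq1 : (1 + (ε / 4) ^ 2 / 8)⁻¹ < 1 := inv_lt_one_of_one_lt₀ (by
    have : 0 < (ε / 4) ^ 2 / 8 := by positivity
    linarith)
  -- Entropy `n` against decay `k s`, with ratio `k · (s / n)`; in `hB`, `s` against `n k`, with
  -- ratio `k · (n / s)`. Both diverge because `s / n → c > 0`.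
  have hA := tendsto_const_pow_mul_pow hC hq0 hq1 (a := fun n => n) (b := fun n => k n * s n) hn (by
    refine (hkR.atTop_mul_pos hc hs).congr fun n => ?_
    push_cast
    ring)
  have hB := tendsto_const_pow_mul_pow hC hq0 hq1 (a := s) (b := fun n => n * k n) hsR (by
    refine (hkR.atTop_mul_pos (inv_pos.2 hc) (hs.inv₀ hc.ne')).congr fun n => ?_
    push_cast
    rw [inv_div]
    ring)
  have hsum := hA.add hB
  rw [add_zero] at hsum
  refine tendsto_of_tendsto_of_tendsto_of_le_of_le' tendsto_const_nhds hsum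
    (Eventually.of_forall fun _ => zero_le) ?_
  filter_upwards [eventually_gt_atTop 0, hk.eventually_gt_atTop 0, hsR.eventually_gt_atTop 0]
    with n hn0 hk0 hs0
  have hs0' : 0 < s n := by exact_mod_cast hs0
  have : NeZero n := ⟨hn0.ne'⟩
  have : NeZero (k n) := ⟨hk0.ne'⟩
  have : NeZero (s n) := ⟨hs0'.ne'⟩
  have h1 := uniformSphere_not_nearlyIsometric_le
    (Equiv.prodAssoc (Fin n) (Fin (k n)) (Fin (s n))) hε hε1
  have h2 := uniformSphere_not_nearlyIsometric_le
    (Equiv.prodComm (Fin n × Fin (k n)) (Fin (s n))) hε hε1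
  simp only [Fintype.card_prod, Fintype.card_fin] at h1 h2
  refine le_trans (measure_mono ?_) ((measure_union_le _ _).trans (add_le_add h1 h2))
  intro ψ hψ
  exact not_and_or.1 hψ

theorem theorem4p1
    {Ω : ℕ → Type*} [∀ n, MeasurableSpace (Ω n)]
    (P : ∀ n, Measure (Ω n)) [∀ n, IsProbabilityMeasure (P n)]
    (k s : ℕ → ℕ) (c : ℝ) (hc : 0 < c)
    (hk : Tendsto k atTop atTop)
    (hs : Asymptotics.IsEquivalent atTop (fun n => (s n : ℝ)) (fun n => c * (n : ℝ)))
    (ρ : ∀ n, Ω n → Matrix (Fin n × Fin (k n)) (Fin n × Fin (k n)) ℂ)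
    (hρ : ∀ᶠ n in atTop,
      HasLaw (ρ n) (inducedMeasure (Fin n × Fin (k n)) (Fin (s n))) (P n)) :
    (c < 1 → Tendsto (fun n => P n {ω | HasPositiveReduction (ρ n ω)}) atTop (𝓝 0)) ∧
    (1 < c → Tendsto (fun n => P n {ω | HasPositiveReduction (ρ n ω)}) atTop (𝓝 1)) := by
  have hsc : Tendsto (fun n => (s n : ℝ) / n) atTop (𝓝 c) := by
    have h1 := (Asymptotics.isEquivalent_iff_tendsto_one (by
      filter_upwards [eventually_gt_atTop 0] with n hn
      have : (0 : ℝ) < n := by exact_mod_cast hn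
      positivity)).1 hs
    have h2 := h1.const_mul c
    rw [mul_one] at h2
    refine h2.congr' ?_
    filter_upwards [eventually_gt_atTop 0] with n hn
    simp only [Pi.div_apply]
    field_simp
  have hP : ∀ᶠ n in atTop, P n {ω | HasPositiveReduction (ρ n ω)} =
      uniformSphere ((Fin n × Fin (k n)) × Fin (s n)) {ψ | HasPositiveReduction
        (partialTrace (pureState ψ.1))} := by
    filter_upwards [hρ] with n hn
    rw [hn.measure_eq measurableSet_hasPositiveReduction, inducedMeasure_hasPositiveReduction]
  have hspos : ∀ᶠ n in atTop, 0 < n ∧ 0 < k n ∧ 0 < s n := by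
    filter_upwards [eventually_gt_atTop 0, hk.eventually_gt_atTop 0,
      hsc.eventually (lt_mem_nhds hc)] with n hn hkn hsn
    refine ⟨hn, hkn, Nat.pos_of_ne_zero fun h0 => ?_⟩
    simp [h0] at hsn
  constructor
  · intro hc1
    -- At `ε = 0` the inequality reads `c < 1`; continuity leaves room for a small positive `ε`.
    obtain ⟨ε, hεlt, hε0, hε1⟩ : ∃ ε : ℝ, c * (1 + ε) ^ 2 < (1 - ε) ^ 2 ∧ 0 < ε ∧ ε < 1 := by
      have hcont : Tendsto (fun ε : ℝ => (1 - ε) ^ 2 - c * (1 + ε) ^ 2) (𝓝[>] 0)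
          (𝓝 ((1 - 0) ^ 2 - c * (1 + 0) ^ 2)) :=
        (Continuous.tendsto (by fun_prop) _).mono_left nhdsWithin_le_nhds
      have h1 := hcont.eventually (lt_mem_nhds (a := 0) (by linarith))
      obtain ⟨ε, h2, h3⟩ := (h1.and (Ioo_mem_nhdsGT one_pos)).exists
      exact ⟨ε, by linarith, h3.1, h3.2⟩
    refine tendsto_of_tendsto_of_tendsto_of_le_of_le' tendsto_const_nhds
      (tendsto_uniformSphere_not_nearlyIsometric hc hε0 hε1.le hk hsc)
      (Eventually.of_forall fun _ => zero_le) ?_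
    have hev := (hsc.mul_const ((1 + ε) ^ 2)).eventually (gt_mem_nhds hεlt)
    filter_upwards [hP, hspos, hev] with n hPn hpos hn
    have : NeZero (s n) := ⟨hpos.2.2.ne'⟩
    have hn0 : (0 : ℝ) < n := by exact_mod_cast hpos.1
    rw [hPn]
    refine measure_mono fun ψ hψ hgood => ?_
    refine not_hasPositiveReduction_of_nearlyIsometric hε0.le hε1 hgood.1 hgood.2 ?_ hψ
    simp only [Fintype.card_fin]
    rw [div_mul_eq_mul_div, div_lt_iff₀ hn0] at hn
    linarith
  · intro hc1
    obtain ⟨ε, hεlt, hε0, hε1⟩ : ∃ ε : ℝ, (1 + ε) ^ 2 < c * (1 - ε) ^ 2 ∧ 0 < ε ∧ ε < 1 := by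
      have hcont : Tendsto (fun ε : ℝ => c * (1 - ε) ^ 2 - (1 + ε) ^ 2) (𝓝[>] 0)
          (𝓝 (c * (1 - 0) ^ 2 - (1 + 0) ^ 2)) :=
        (Continuous.tendsto (by fun_prop) _).mono_left nhdsWithin_le_nhds
      have h1 := hcont.eventually (lt_mem_nhds (a := 0) (by linarith))
      obtain ⟨ε, h2, h3⟩ := (h1.and (Ioo_mem_nhdsGT one_pos)).exists
      exact ⟨ε, by linarith, h3.1, h3.2⟩
    have hlow := ENNReal.Tendsto.sub (tendsto_const_nhds (x := (1 : ENNReal)))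
      (tendsto_uniformSphere_not_nearlyIsometric hc hε0 hε1.le hk hsc) (Or.inl ENNReal.one_ne_top)
    rw [tsub_zero] at hlow
    refine tendsto_of_tendsto_of_tendsto_of_le_of_le' hlow tendsto_const_nhds ?_
      (Eventually.of_forall fun n => prob_le_one)
    have hev := (hsc.mul_const ((1 - ε) ^ 2)).eventually (lt_mem_nhds hεlt)
    filter_upwards [hP, hspos, hev] with n hPn hpos hn
    have : NeZero n := ⟨hpos.1.ne'⟩
    have : NeZero (k n) := ⟨hpos.2.1.ne'⟩
    have : NeZero (s n) := ⟨hpos.2.2.ne'⟩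
    have hn0 : (0 : ℝ) < n := by exact_mod_cast hpos.1
    -- The sphere is covered by positive reduction and failure of flatness; subadditivity needs no
    -- measurability of the latter.
    rw [hPn, tsub_le_iff_right,
      ← measure_univ (μ := uniformSphere ((Fin n × Fin (k n)) × Fin (s n)))]
    refine le_trans (measure_mono fun ψ _ => ?_) (measure_union_le _ _)
    by_cases hgood : NearlyIsometric (Equiv.prodAssoc _ _ _) ε ψ.1 ∧
        NearlyIsometric (Equiv.prodComm _ _) ε ψ.1
    · refine Or.inl (hasPositiveReduction_of_nearlyIsometric hε0.le hε1.le hgood.1 hgood.2 ?_)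
      simp only [Fintype.card_fin]
      rw [div_mul_eq_mul_div, lt_div_iff₀ hn0] at hn
      linarith
    · exact Or.inr hgood
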